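/- **Conventions.** A flow of a monoid $M$ on an object $X$ of a category $\mathcal C$ is a monoid morphism $M\to\mathcal C(X,X)$. For a category $\mathcal C$ of spaces and a constraint $\mathcal F$ on flows, ${}_{\mathcal F}\mathcal C^{M}$ is the category of flows of $M$ on objects of $\mathcal C$ that satisfy $\mathcal F$, with the $M$-equivariant morphisms of $\mathcal C$. A full inclusion is reflective if it has a left adjoint. Below, $\mathcal S,\mathcal J$ are arbitrary families of subsets of $M$. $\mathrm{Top}_{T_{2f}}$ is the category of functionally Hausdorff spaces (continuous real functions separate points), $\mathrm{Top}_{T_{3\frac12}}$ that of Tychonoff spaces, $\mathrm{Cpct}_{T_2}$ that of compact Hausdorff spaces, and $\mathrm{Unif}_{T_2,c}$ that of complete Hausdorff uniform spaces. $\mathrm{Cpct}_{T_2}$ is also regarded as a full subcategory of $\mathrm{Unif}$ through the unique compatible uniformity. $\mathrm{Top}_\kappa$ is the category of spaces whose open sets are those having open trace on each compact subspace, $\kappa:\mathrm{Top}\to\mathrm{Top}_\kappa$ is its coreflection, and $X\times^\kappa Y=\kappa(X\times Y)$. **Corollary.** In each of the following cases, let $\mathcal C\subseteq\mathcal D$ be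 two of the listed categories. Then the inclusion $\mathcal C\hookrightarrow\mathcal D$ is reflective, and the corresponding inclusion ${}_{\mathcal F}\mathcal C^{M}\hookrightarrow{}_{\mathcal F}\mathcal D^{M}$ is also reflective. (a) $M$ is a topological monoid; the categories are $\mathrm{Top}_\bullet$ with $\bullet\in\{\text{blank},T_0,T_1,T_2,T_{2f},T_{3\frac12}\}$ and $\mathrm{Cpct}_{T_2}$; $\mathcal F$ requires the action $M\times X\to X$ to be separately continuous over $S\times X$ for $S\in\mathcal S$ and jointly continuous over $J\times X$ for $J\in\mathcal J$. (b) $M$ is a monoid equipped with a uniformity; the categories are $\mathrm{Unif}_\bullet$ with $\bullet\in\{\text{blank},T_2,(T_2,c)\}$ and $\mathrm{Cpct}_{T_2}$; $\mathcal F$ requires the action to be separately uniformly continuous over $S\times X$ for $S\in\mathcal S$ and jointly uniformly continuous over $J\times X$ for $J\in\mathcal J$. (c) $M$ is a monoid internal to $(\mathrm{Top}_\kappa,\times^\kappa)$; the categories are $\mathrm{Top}_\kappa$, its full subcategory $\mathrm{Top}_{T_2,\kappa}$ of Hausdorff spaces, and $\mathrm{Cpct}_{T_2}$; $\mathcal F$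 requires the action to be separately continuous over $\kappa(S)\times X$ for $S\in\mathcal S$ and jointly continuous over $\kappa(J)\times^\kappa X$ for $J\in\mathcal J$. (d) $M=G$ is a topological group; the categories are those of (b); $\mathcal F$ requires the flow either to be bounded (for each entourage $V$ of $X$ there is a neighborhood $N$ of $1\in G$ with $(s\triangleright x,x)\in V$ for all $s\in N$, $x\in X$), or to be quasi-bounded (for each entourage $W$ of $X$ there are a neighborhood $N$ of $1\in G$ and an entourage $V$ with $(s\triangleright x,s\triangleright y)\in W$ for all $s\in N$, $(x,y)\in V$). Moreover, for a topological group $G$ and $\mathcal D$ any of the categories in (b), the embedding of the category of jointly continuous $G$-flows on compact Hausdorff spaces into the category of bounded $G$-flows in $\mathcal D$ (equipping a compact Hausdorff space with its unique compatible uniformity) is reflective. In particular, for a topological group $G$, every continuous $G$-flow has a universal continuous compact Hausdorff $G$-equivariant compactification (case (a) with $\mathcal C=\mathrm{Cpct}_{T_2}$, $\mathcal D=\mathrm{Top}$, $\mathcal S=\emptyset$, $\mathcal J=\{G\}$), and every uniform flow as in (b) or (d) has a universal equivariant Hausdorff completion ($\mathcal C=\mathrm{Unif}_{T_2,c}$,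 $\mathcal D=\mathrm{Unif}$). -/

import Mathlib

open CategoryTheory Topology Uniformity

universe v u

namespace FlowCat

/-! ### Flows

A flow of a monoid `M` on an object `X` of a category is a monoid morphism from `M` to the
endomorphisms of `X`; flows and equivariant morphisms form Mathlib's category `Action C M`. -/

/-- The uncurried set map `M × X → X` underlying a flow on a topological space. -/
def topAct {M : Type v} [Monoid M] (X : Action TopCat.{u} M) (m : M) (x : X.V) : X.V :=
  (ConcreteCategory.hom (X.ρ m : X.V ⟶ X.V)) x

theorem topAct_one {M : Type v} [Monoid M] (X : Action TopCat.{u} M) (x : X.V) :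
    topAct X 1 x = x :=
  ConcreteCategory.congr_hom X.ρ.map_one x

theorem topAct_mul {M : Type v} [Monoid M] (X : Action TopCat.{u} M) (m n : M) (x : X.V) :
    topAct X (m * n) x = topAct X m (topAct X n x) :=
  ConcreteCategory.congr_hom (X.ρ.map_mul m n) x

/-- The uncurried set map `M × X → X` underlying a flow on a uniform space. -/
def unifAct {M : Type v} [Monoid M] (X : Action UniformSpaceCat.{u} M) (m : M) (x : X.V) : X.V :=
  (ConcreteCategory.hom (X.ρ m : X.V ⟶ X.V)) x

/-! ### The base categories, as full subcategories -/

/-- A space is functionally Hausdorff if continuous real functions separate its points. -/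
def FunctionallyHausdorff (X : Type u) [TopologicalSpace X] : Prop :=
  ∀ x y : X, x ≠ y → ∃ f : X → ℝ, Continuous f ∧ f x ≠ f y

/-- Labels for full subcategories of topological spaces: all spaces, the spaces satisfying one of
the separation axioms, and the compact Hausdorff spaces. -/
inductive TopClass
  | blank | T0 | T1 | T2 | functionallyT2 | tychonoff | compactT2

/-- The full subcategory of `TopCat` named by a label. -/
def TopClass.prop : TopClass → ObjectProperty TopCat.{u}
  | .blank => fun _ => True
  | .T0 => fun X => T0Space X
  | .T1 => fun X => T1Space X
  | .T2 => fun X => T2Space X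
  | .functionallyT2 => fun X => FunctionallyHausdorff X
  | .tychonoff => fun X => T35Space X
  | .compactT2 => fun X => CompactSpace X ∧ T2Space X

/-- Labels for full subcategories of uniform spaces: all, Hausdorff, complete Hausdorff, and
compact Hausdorff uniform spaces (the last ones are the compact Hausdorff spaces, each with its
unique compatible uniformity). -/
inductive UnifClass
  | blank | T2 | completeT2 | compactT2

/-- The full subcategory of `UniformSpaceCat` named by a label. -/
def UnifClass.prop : UnifClass → ObjectProperty UniformSpaceCat.{u}
  | .blank => fun _ => True
  | .T2 => fun X => T2Space X
  | .completeT2 => fun X => CompleteSpace X ∧ T2Space X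
  | .compactT2 => fun X => CompactSpace X ∧ T2Space X

/-- Labels for full subcategories of compactly generated spaces: all, Hausdorff, and
compact Hausdorff ones. -/
inductive KTopClass
  | blank | T2 | compactT2

/-- The full subcategory of `TopCat` named by a label. A space is compactly generated when a set
is open as soon as its trace on every compact subspace is open there; this is
`CompactlyCoherentSpace`. -/
def KTopClass.prop : KTopClass → ObjectProperty TopCat.{u}
  | .blank => fun X => CompactlyCoherentSpace X
  | .T2 => fun X => CompactlyCoherentSpace X ∧ T2Space X
  | .compactT2 => fun X => CompactlyCoherentSpace X ∧ CompactSpace X ∧ T2Space X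

/-! ### Constraints on flows and the flow categories -/

/-- Flows of `M` on the spaces of a class `C` that are separately continuous over `S × X` for
`S ∈ 𝒮` and jointly continuous over `J × X` for `J ∈ 𝒥`. Continuity in the variable of `X` is
part of being a flow in topological spaces. -/
def topFlows (M : Type v) [Monoid M] [TopologicalSpace M] (𝒮 𝒥 : Set (Set M)) (C : TopClass) :
    ObjectProperty (Action TopCat.{u} M) := fun X =>
  C.prop X.V ∧
  (∀ S ∈ 𝒮, ∀ x : X.V, Continuous fun s : S => topAct X (s : M) x) ∧
  (∀ J ∈ 𝒥, Continuous fun p : J × X.V => topAct X (p.1 : M) p.2)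

/-- Flows of `M` on the uniform spaces of a class `C` that are separately uniformly continuous over
`S × X` for `S ∈ 𝒮` and jointly uniformly continuous over `J × X` for `J ∈ 𝒥`. -/
def unifFlows (M : Type v) [Monoid M] [UniformSpace M] (𝒮 𝒥 : Set (Set M)) (C : UnifClass) :
    ObjectProperty (Action UniformSpaceCat.{u} M) := fun X =>
  C.prop X.V ∧
  (∀ S ∈ 𝒮, ∀ x : X.V, UniformContinuous fun s : S => unifAct X (s : M) x) ∧
  (∀ J ∈ 𝒥, UniformContinuous fun p : J × X.V => unifAct X (p.1 : M) p.2)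

/-- Continuity of a map for the compactly generated refinement `κ(X)` of the topology of `X`. -/
def KContinuous {X : Type v} {Y : Type u} [TopologicalSpace X] [TopologicalSpace Y]
    (f : X → Y) : Prop :=
  Continuous fun x : CompactCoherentification X => f ((CompactCoherentification.mk X).symm x)

/-- A monoid internal to compactly generated spaces: the space is compactly generated and the
multiplication is continuous on the `κ`-product `κ(M × M)`. -/
class IsKMonoid (M : Type v) [Monoid M] [TopologicalSpace M] : Prop where
  compactlyGenerated : CompactlyCoherentSpace M
  continuous_mul : KContinuous fun p : M × M => p.1 * p.2

/-- Flows of `M` on the compactly generated spaces of a class `C` that are separately continuous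
over `κ(S) × X` for `S ∈ 𝒮`, and jointly continuous over the `κ`-product of `κ(J)` and `X`, that is
on `κ(κ(J) × X)`, for `J ∈ 𝒥`. -/
def kFlows (M : Type v) [Monoid M] [TopologicalSpace M] (𝒮 𝒥 : Set (Set M)) (C : KTopClass) :
    ObjectProperty (Action TopCat.{u} M) := fun X =>
  C.prop X.V ∧
  (∀ S ∈ 𝒮, ∀ x : X.V, KContinuous fun s : S => topAct X (s : M) x) ∧
  (∀ J ∈ 𝒥, KContinuous fun p : CompactCoherentification J × X.V =>
    topAct X (((CompactCoherentification.mk J).symm p.1 : J) : M) p.2)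

/-- Bounded (equiuniform) flows of a topological group on the uniform spaces of a class `C`. -/
def boundedFlows (G : Type v) [Group G] [TopologicalSpace G] (C : UnifClass) :
    ObjectProperty (Action UniformSpaceCat.{u} G) := fun X =>
  C.prop X.V ∧
  ∀ V ∈ 𝓤 X.V, ∃ N ∈ 𝓝 (1 : G), ∀ s ∈ N, ∀ y : X.V, (unifAct X s y, y) ∈ V

/-- Quasi-bounded (`π`-uniform) flows of a topological group on the uniform spaces of a
class `C`. -/
def quasiBoundedFlows (G : Type v) [Group G] [TopologicalSpace G] (C : UnifClass) :
    ObjectProperty (Action UniformSpaceCat.{u} G) := fun X =>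
  C.prop X.V ∧
  ∀ W ∈ 𝓤 X.V, ∃ N ∈ 𝓝 (1 : G), ∃ V ∈ 𝓤 X.V,
    ∀ s ∈ N, ∀ x y : X.V, (x, y) ∈ V → (unifAct X s x, unifAct X s y) ∈ W

/-! ### The inclusions -/

theorem topFlows_le (M : Type v) [Monoid M] [TopologicalSpace M] (𝒮 𝒥 : Set (Set M))
    {C D : TopClass} (h : (C.prop : ObjectProperty TopCat.{u}) ≤ D.prop) :
    topFlows.{v, u} M 𝒮 𝒥 C ≤ topFlows M 𝒮 𝒥 D :=
  fun _ hX => ⟨h _ hX.1, hX.2⟩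

theorem unifFlows_le (M : Type v) [Monoid M] [UniformSpace M] (𝒮 𝒥 : Set (Set M))
    {C D : UnifClass} (h : (C.prop : ObjectProperty UniformSpaceCat.{u}) ≤ D.prop) :
    unifFlows.{v, u} M 𝒮 𝒥 C ≤ unifFlows M 𝒮 𝒥 D :=
  fun _ hX => ⟨h _ hX.1, hX.2⟩

theorem kFlows_le (M : Type v) [Monoid M] [TopologicalSpace M] (𝒮 𝒥 : Set (Set M))
    {C D : KTopClass} (h : (C.prop : ObjectProperty TopCat.{u}) ≤ D.prop) :
    kFlows.{v, u} M 𝒮 𝒥 C ≤ kFlows M 𝒮 𝒥 D :=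
  fun _ hX => ⟨h _ hX.1, hX.2⟩

theorem boundedFlows_le (G : Type v) [Group G] [TopologicalSpace G]
    {C D : UnifClass} (h : (C.prop : ObjectProperty UniformSpaceCat.{u}) ≤ D.prop) :
    boundedFlows.{v, u} G C ≤ boundedFlows G D :=
  fun _ hX => ⟨h _ hX.1, hX.2⟩

theorem quasiBoundedFlows_le (G : Type v) [Group G] [TopologicalSpace G]
    {C D : UnifClass} (h : (C.prop : ObjectProperty UniformSpaceCat.{u}) ≤ D.prop) :
    quasiBoundedFlows.{v, u} G C ≤ quasiBoundedFlows G D :=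
  fun _ hX => ⟨h _ hX.1, hX.2⟩

/-! ### Compact Hausdorff spaces as uniform spaces -/

/-- A compact Hausdorff space with its unique compatible uniformity. -/
noncomputable def compactUnif (X : Type u) [TopologicalSpace X] [CompactSpace X] [T2Space X] :
    UniformSpaceCat.{u} :=
  letI := uniformSpaceOfCompactR1 (γ := X)
  UniformSpaceCat.of X

theorem compactUnif_prop (X : Type u) [TopologicalSpace X] [hc : CompactSpace X] [ht : T2Space X]
    (D : UnifClass) : D.prop (compactUnif X) := by
  let _ := uniformSpaceOfCompactR1 (γ := X)
  cases D with
  | blank => trivial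
  | T2 => exact ht
  | completeT2 => exact ⟨(inferInstance : CompleteSpace X), ht⟩
  | compactT2 => exact ⟨hc, ht⟩

/-- Continuous maps of compact Hausdorff spaces are uniformly continuous. -/
noncomputable def compactUnifMap {X Y : Type u} [TopologicalSpace X] [CompactSpace X] [T2Space X]
    [TopologicalSpace Y] [CompactSpace Y] [T2Space Y] (f : X → Y) (hf : Continuous f) :
    compactUnif X ⟶ compactUnif Y :=
  letI := uniformSpaceOfCompactR1 (γ := X)
  letI := uniformSpaceOfCompactR1 (γ := Y)
  UniformSpaceCat.ofHom ⟨f, CompactSpace.uniformContinuous_of_continuous hf⟩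

/-- The embedding of compact Hausdorff spaces into (Hausdorff, complete Hausdorff) uniform
spaces. -/
noncomputable def compactToUnif (D : UnifClass) :
    (TopClass.compactT2.prop : ObjectProperty TopCat.{u}).FullSubcategory ⥤
      (D.prop : ObjectProperty UniformSpaceCat.{u}).FullSubcategory where
  obj X :=
    haveI := X.property.1
    haveI := X.property.2
    ⟨compactUnif X.obj, compactUnif_prop X.obj D⟩
  map {X Y} f :=
    haveI := X.property.1
    haveI := X.property.2
    haveI := Y.property.1
    haveI := Y.property.2
    ObjectProperty.homMk (compactUnifMap (ConcreteCategory.hom f.hom)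
      (ConcreteCategory.hom f.hom).continuous)

/-- The uniform flow on a compact Hausdorff flow. -/
noncomputable def compactUnifFlow {G : Type v} [Group G] (X : Action TopCat.{u} G)
    [CompactSpace X.V] [T2Space X.V] : Action UniformSpaceCat.{u} G where
  V := compactUnif X.V
  ρ :=
    { toFun := fun g => compactUnifMap (topAct X g)
        (ConcreteCategory.hom (X.ρ g : X.V ⟶ X.V)).continuous
      map_one' := by
        apply UniformSpaceCat.hom_ext
        funext x
        exact topAct_one X x
      map_mul' := fun g h => by
        apply UniformSpaceCat.hom_ext
        funext x
        exact topAct_mul X g h x }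

/-- A jointly continuous flow of a topological group on a compact Hausdorff space is bounded. -/
theorem compactUnifFlow_bounded {G : Type v} [Group G] [TopologicalSpace G]
    (X : Action TopCat.{u} G) [CompactSpace X.V] [T2Space X.V] (D : UnifClass)
    (hX : topFlows.{v, u} G ∅ {Set.univ} .compactT2 X) :
    boundedFlows.{v, u} G D (compactUnifFlow X) := by
  refine ⟨compactUnif_prop X.V D, ?_⟩
  let _ := uniformSpaceOfCompactR1 (γ := X.V)
  have hc : Continuous fun p : G × X.V => topAct X p.1 p.2 := by
    have h := hX.2.2 Set.univ rfl
    exact h.comp (((continuous_fst.subtype_mk fun _ => Set.mem_univ _).prodMk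
      continuous_snd : Continuous fun p : G × X.V => ((⟨p.1, Set.mem_univ _⟩ : Set.univ), p.2)))
  intro V hV
  change V ∈ 𝓤 X.V at hV
  change ∃ N ∈ 𝓝 (1 : G), ∀ s ∈ N, ∀ y : X.V, (topAct X s y, y) ∈ V
  have key : ∀ᶠ s in 𝓝 (1 : G), ∀ y ∈ (Set.univ : Set X.V), (topAct X s y, y) ∈ V := by
    apply isCompact_univ.eventually_forall_of_forall_eventually
    intro y _
    have h2 : Continuous fun p : G × X.V => (topAct X p.1 p.2, p.2) :=
      hc.prodMk continuous_snd
    have h4 : V ∈ 𝓝 (topAct X 1 y, y) := by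
      rw [topAct_one]; exact nhds_le_uniformity y hV
    have h5 := h2.continuousAt (x := ((1 : G), y)) h4
    exact h5
  exact ⟨_, key, fun s hs y => hs y trivial⟩

/-- The embedding of the continuous compact Hausdorff flows of a topological group into its bounded
uniform flows. -/
noncomputable def compactFlowToBounded (G : Type v) [Group G] [TopologicalSpace G]
    (D : UnifClass) :
    (topFlows.{v, u} G ∅ {Set.univ} .compactT2).FullSubcategory ⥤
      (boundedFlows.{v, u} G D).FullSubcategory where
  obj X :=
    haveI := X.property.1.1
    haveI := X.property.1.2
    ⟨compactUnifFlow X.obj, compactUnifFlow_bounded X.obj D X.property⟩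
  map {X Y} f :=
    haveI := X.property.1.1
    haveI := X.property.1.2
    haveI := Y.property.1.1
    haveI := Y.property.1.2
    ObjectProperty.homMk
      { hom := compactUnifMap (ConcreteCategory.hom f.hom.hom)
          (ConcreteCategory.hom f.hom.hom).continuous
        comm := fun g => by
          apply UniformSpaceCat.hom_ext
          funext x
          exact ConcreteCategory.congr_hom (f.hom.comm g) x }

end FlowCat

namespace FlowCat

universe v₁ u₁ v₂ u₂ w

/-! ### Universal arrows and reflections -/

/-! A left adjoint to a full inclusion amounts to a universal arrow out of each object, and these
are built as in Freyd's adjoint functor theorem. Given equivariant maps from `X` to flows `Z i` of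
the target class, take the image of `X` in the product of the `Z i`, or the closure of that image
when completeness or compactness is required. This subset is invariant, and the class survives the
passage to it: the separation axioms used are productive and hereditary, complete Hausdorff and
compact Hausdorff spaces are productive and closed-hereditary, and each constraint on the action can
be tested coordinatewise in an initial structure. In the compactly generated setting the subspace is
afterwards refined by `κ`, which preserves maps out of compactly generated spaces.

A surjective image, or a Hausdorff space with a dense image, of `X` injects into the double power
set of `X`, so up to isomorphism only a set of such arrows exists. Factoring through all of them at
once gives the universal arrow (`HasUniversalArrow.of_factorization`); uniqueness holds because
surjections, and dense maps tested against Hausdorff targets, are right-cancellable.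

The reflections without action are the case of the trivial monoid. The embeddings of compact
Hausdorff spaces and flows reduce to full subcategories of uniform objects, since the compatible
uniformity is unique and, on compact Hausdorff spaces, bounded flows of a topological group are
exactly the jointly continuous ones. -/

/-- There is a universal arrow from `X` to the objects satisfying `P`. -/
def HasUniversalArrow {𝓔 : Type u₁} [Category.{v₁} 𝓔] (P : ObjectProperty 𝓔) (X : 𝓔) : Prop :=
  ∃ R, P R ∧ ∃ η : X ⟶ R, ∀ Z, P Z → ∀ f : X ⟶ Z, ∃! g : R ⟶ Z, η ≫ g = f

theorem HasUniversalArrow.of_prop {𝓔 : Type u₁} [Category.{v₁} 𝓔] {P : ObjectProperty 𝓔} {X : 𝓔}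
    (h : P X) : HasUniversalArrow P X :=
  ⟨X, h, 𝟙 X, fun _ _ f => ⟨f, Category.id_comp f, fun g hg => by simpa using hg⟩⟩

theorem nonempty_reflective {𝓐 : Type u₁} [Category.{v₁} 𝓐] {𝓑 : Type u₂} [Category.{v₂} 𝓑]
    (F : 𝓐 ⥤ 𝓑) [F.Full] [F.Faithful]
    (h : ∀ X : 𝓑, ∃ (Y : 𝓐) (η : X ⟶ F.obj Y), ∀ (Z : 𝓐) (f : X ⟶ F.obj Z),
      ∃! g : Y ⟶ Z, η ≫ F.map g = f) :
    Nonempty (Reflective F) := by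
  choose L η l hl hu using h
  let e (X : 𝓑) (Z : 𝓐) : (L X ⟶ Z) ≃ (X ⟶ F.obj Z) :=
    { toFun := fun g => η X ≫ F.map g
      invFun := fun f => l X Z f
      left_inv := fun g => (hu X Z _ g rfl).symm
      right_inv := fun f => hl X Z f }
  have he : ∀ (X : 𝓑) (Z Z' : 𝓐) (g : Z ⟶ Z') (k : L X ⟶ Z),
      e X Z' (k ≫ g) = e X Z k ≫ F.map g := fun X Z Z' g k => by simp [e]
  exact ⟨{ L := Adjunction.leftAdjointOfEquiv e he, adj := Adjunction.adjunctionOfEquivLeft e he }⟩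

theorem nonempty_reflective_ιOfLE {𝓔 : Type u₁} [Category.{v₁} 𝓔] {P Q : ObjectProperty 𝓔}
    (hPQ : P ≤ Q) (h : ∀ X, Q X → HasUniversalArrow P X) :
    Nonempty (Reflective (ObjectProperty.ιOfLE hPQ)) := by
  refine nonempty_reflective _ fun X => ?_
  obtain ⟨R, hR, η, hη⟩ := h X.obj X.property
  refine ⟨⟨R, hR⟩, ObjectProperty.homMk η, fun Z f => ?_⟩
  obtain ⟨g, hg, hu⟩ := hη Z.obj Z.property f.hom
  refine ⟨ObjectProperty.homMk g, ObjectProperty.hom_ext _ hg, fun k hk => ?_⟩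
  exact ObjectProperty.hom_ext _ (hu k.hom (congrArg (fun t => t.hom) hk))

/-- Universal arrows for objects, from universal arrows for the flows of the trivial monoid. -/
theorem HasUniversalArrow.of_trivial {𝓓 : Type u₁} [Category.{v₁} 𝓓] {P : ObjectProperty 𝓓}
    {Q : ObjectProperty (Action 𝓓 PUnit.{w + 1})} (hQ : ∀ Y, Q Y ↔ P Y.V) {X : 𝓓}
    (h : HasUniversalArrow Q (Action.trivial PUnit X)) : HasUniversalArrow P X := by
  have htriv (Y : Action 𝓓 PUnit.{w + 1}) (m : PUnit) : Y.ρ m = 𝟙 Y.V := Y.ρ.map_one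
  obtain ⟨R, hR, η, hη⟩ := h
  refine ⟨R.V, (hQ R).1 hR, η.hom, fun Z hZ f => ?_⟩
  obtain ⟨g, hg, hu⟩ := hη (Action.trivial PUnit Z) ((hQ _).2 hZ)
    { hom := f, comm := fun m => by
        rw [htriv, htriv]; exact (Category.id_comp f).trans (Category.comp_id f).symm }
  refine ⟨g.hom, congrArg Action.Hom.hom hg, fun k hk => ?_⟩
  exact congrArg Action.Hom.hom (hu
    { hom := k, comm := fun m => by
        rw [htriv, htriv]; exact (Category.id_comp k).trans (Category.comp_id k).symm }
    (Action.hom_ext _ _ hk))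

/-- A class `P` of flows has universal arrows if families of equivariant maps into `P` factor
through morphisms whose underlying maps are in `W`, where the morphisms in `W` are right-cancellable for
`P` and essentially small in number. -/
theorem HasUniversalArrow.of_factorization {𝓓 : Type u₁} [Category.{v₁} 𝓓] {M : Type u₂} [Monoid M]
    (P : ObjectProperty (Action 𝓓 M)) (X : Action 𝓓 M)
    (W : ∀ Y : 𝓓, (X.V ⟶ Y) → Prop)
    (factor : ∀ (I : Type w) (Z : I → Action 𝓓 M) (f : ∀ i, X ⟶ Z i), (∀ i, P (Z i)) →
      ∃ (Y : Action 𝓓 M) (e : X ⟶ Y) (m : ∀ i, Y ⟶ Z i),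
        P Y ∧ W Y.V e.hom ∧ ∀ i, e ≫ m i = f i)
    (cancel : ∀ (Y : 𝓓) (e : X.V ⟶ Y), W Y e → ∀ Z, P Z → ∀ a b : Y ⟶ Z.V, e ≫ a = e ≫ b → a = b)
    (small : ∃ (J : Type w) (B : J → 𝓓) (b : ∀ j, X.V ⟶ B j), ∀ (Y : 𝓓) (e : X.V ⟶ Y), W Y e →
      ∃ (j : J) (φ : Y ≅ B j), e ≫ φ.hom = b j) :
    HasUniversalArrow P X := by
  obtain ⟨J, B, b, hB⟩ := small
  -- Smallness concerns underlying arrows only: for each `j` that carries some flow in `P`, one such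
  -- flow is chosen. The product is thus indexed in `Type w`, whatever the universe of `M`.
  let I := { j : J // ∃ (Y : Action 𝓓 M) (e : X ⟶ Y) (φ : Y.V ≅ B j),
    P Y ∧ W Y.V e.hom ∧ e.hom ≫ φ.hom = b j }
  choose Y e φ hP hW hφ using fun i : I => i.2
  obtain ⟨R, η, π, hR, hη, hπ⟩ := factor I Y e hP
  refine ⟨R, hR, η, fun Z hZ f => ?_⟩
  obtain ⟨Y', e', m', hP', hW', hm'⟩ := factor PUnit (fun _ => Z) (fun _ => f) fun _ => hZ
  obtain ⟨j, ψ, hj⟩ := hB Y'.V e'.hom hW'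
  let i : I := ⟨j, Y', e', ψ, hP', hW', hj⟩
  have hθ : (e i).hom ≫ (φ i).hom ≫ ψ.inv = e'.hom := by
    rw [← Category.assoc, hφ i, ← hj, Category.assoc, ψ.hom_inv_id, Category.comp_id]
  let θ : Y i ⟶ Y' :=
    { hom := (φ i).hom ≫ ψ.inv
      -- The chosen flow `Y i` and the flow `Y'` a priori carry different actions on isomorphic
      -- objects. Both make the arrow from `X` equivariant, so cancelling that arrow shows that the
      -- actions agree.
      comm := fun m => by
        apply cancel _ _ (hW i) _ hP'
        calc (e i).hom ≫ (Y i).ρ m ≫ (φ i).hom ≫ ψ.inv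
            = X.ρ m ≫ (e i).hom ≫ (φ i).hom ≫ ψ.inv := ((e i).comm_assoc m _).symm
          _ = e'.hom ≫ Y'.ρ m := by rw [hθ, e'.comm]
          _ = (e i).hom ≫ ((φ i).hom ≫ ψ.inv) ≫ Y'.ρ m := by
            rw [← hθ, Category.assoc] }
  have hθ' : e i ≫ θ = e' := Action.hom_ext _ _ hθ
  have hf : η ≫ π i ≫ θ ≫ m' ⟨⟩ = f := by
    rw [← Category.assoc, hπ, ← Category.assoc, hθ', hm']
  refine ⟨π i ≫ θ ≫ m' ⟨⟩, hf, fun g hg => ?_⟩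
  apply Action.hom_ext
  apply cancel _ _ hη _ hZ
  exact congrArg Action.Hom.hom (hg.trans hf.symm)

/-! ### Smallness -/

theorem exists_injective_of_surjective {X Y : Type u} {e : X → Y} (he : e.Surjective) :
    ∃ j : Y → Set (Set X), j.Injective := by
  refine ⟨fun y => {e ⁻¹' {y}}, fun y y' h => ?_⟩
  obtain ⟨x, rfl⟩ := he y
  have h' : e ⁻¹' {e x} = e ⁻¹' {y'} := Set.singleton_injective h
  have hx : x ∈ e ⁻¹' {e x} := rfl
  rw [h'] at hx
  exact hx

/-- A point is recovered from the trace of its neighbourhood filter on `X`: density makes the trace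
proper, and in a Hausdorff space a proper filter has at most one limit. -/
theorem exists_injective_of_denseRange {X Y : Type u} [TopologicalSpace Y] [T2Space Y] {e : X → Y}
    (he : DenseRange e) : ∃ j : Y → Set (Set X), j.Injective := by
  refine ⟨fun y => (Filter.comap e (𝓝 y)).sets, fun y y' h => ?_⟩
  have h' : Filter.comap e (𝓝 y) = Filter.comap e (𝓝 y') := Filter.filter_eq h
  have : (Filter.comap e (𝓝 y)).NeBot := Filter.comap_neBot_iff.2 fun t ht =>
    (he.exists_mem_open isOpen_interior ⟨y, mem_interior_iff_mem_nhds.2 ht⟩).imp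
      fun _ h => interior_subset h
  refine eq_of_nhds_neBot (Filter.NeBot.mono (f := Filter.map e (Filter.comap e (𝓝 y)))
    inferInstance (le_inf ?_ ?_))
  · exact Filter.map_comap_le
  · rw [h']; exact Filter.map_comap_le

theorem exists_small_topCat (V : TopCat.{u}) :
    ∃ (J : Type u) (B : J → TopCat.{u}) (b : ∀ j, V ⟶ B j), ∀ (Y : TopCat.{u}) (e : V ⟶ Y),
      (∃ k : Y → Set (Set V), k.Injective) → ∃ (j : J) (φ : Y ≅ B j), e ≫ φ.hom = b j := by
  -- Every admissible target is transported to a subset of the double power set of `V`; these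
  -- subsets, the topologies on them and the arrows from `V` together form a type in the same
  -- universe.
  refine ⟨Σ (A : Set (Set (Set V))) (t : TopologicalSpace A), V ⟶ @TopCat.of A t,
    fun j => @TopCat.of j.1 j.2.1, fun j => j.2.2, fun Y e ⟨k, hk⟩ => ?_⟩
  let q := Equiv.ofInjective k hk
  let t : TopologicalSpace (Set.range k) := TopologicalSpace.induced q.symm inferInstance
  let ψ : Y ≃ₜ Set.range k := (q.symm.toHomeomorphOfIsInducing ⟨rfl⟩).symm
  exact ⟨⟨_, t, e ≫ (TopCat.isoOfHomeo (Y := TopCat.of (Set.range k)) ψ).hom⟩,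
    TopCat.isoOfHomeo (Y := TopCat.of (Set.range k)) ψ, rfl⟩

theorem exists_small_uniformSpaceCat (V : UniformSpaceCat.{u}) :
    ∃ (J : Type u) (B : J → UniformSpaceCat.{u}) (b : ∀ j, V ⟶ B j),
      ∀ (Y : UniformSpaceCat.{u}) (e : V ⟶ Y),
      (∃ k : Y → Set (Set V), k.Injective) → ∃ (j : J) (φ : Y ≅ B j), e ≫ φ.hom = b j := by
  refine ⟨Σ (A : Set (Set (Set V))) (t : UniformSpace A), V ⟶ @UniformSpaceCat.of A t,
    fun j => @UniformSpaceCat.of j.1 j.2.1, fun j => j.2.2, fun Y e ⟨k, hk⟩ => ?_⟩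
  let q := Equiv.ofInjective k hk
  let t : UniformSpace (Set.range k) := UniformSpace.comap q.symm inferInstance
  have hq : IsUniformInducing q.symm := ⟨rfl⟩
  let φ : Y ≅ UniformSpaceCat.of (Set.range k) :=
    { hom := UniformSpaceCat.ofHom ⟨q, hq.uniformContinuous_iff.2 (by
        have : q.symm ∘ q = id := by ext; simp
        rw [this]; exact uniformContinuous_id)⟩
      inv := UniformSpaceCat.ofHom ⟨q.symm, hq.uniformContinuous⟩
      hom_inv_id := UniformSpaceCat.hom_ext (funext fun y => q.symm_apply_apply y)
      inv_hom_id := UniformSpaceCat.hom_ext (funext fun y => q.apply_symm_apply y) }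
  exact ⟨⟨_, t, e ≫ φ.hom⟩, φ, rfl⟩

/-! ### Topological flows: cancellable arrows and invariant subspaces of products. -/

section Top

variable {M : Type v} [Monoid M]

theorem HasUniversalArrow.of_surjective_factorization_top
    (P : ObjectProperty (Action TopCat.{u} M)) (X : Action TopCat.{u} M)
    (factor : ∀ (I : Type u) (Z : I → Action TopCat.{u} M) (f : ∀ i, X ⟶ Z i), (∀ i, P (Z i)) →
      ∃ (Y : Action TopCat.{u} M) (e : X ⟶ Y) (m : ∀ i, Y ⟶ Z i),
        P Y ∧ Function.Surjective e.hom ∧ ∀ i, e ≫ m i = f i) :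
    HasUniversalArrow P X := by
  obtain ⟨J, B, b, h⟩ := exists_small_topCat X.V
  refine .of_factorization P X (fun _ e => Function.Surjective e) factor ?_
    ⟨J, B, b, fun Y e he => h Y e (exists_injective_of_surjective he)⟩
  intro Y e he Z _ a a' haa'
  ext y
  obtain ⟨x, rfl⟩ := he y
  exact ConcreteCategory.congr_hom haa' x

theorem HasUniversalArrow.of_denseRange_factorization_top
    (P : ObjectProperty (Action TopCat.{u} M)) (hP : ∀ Y, P Y → T2Space Y.V)
    (X : Action TopCat.{u} M)
    (factor : ∀ (I : Type u) (Z : I → Action TopCat.{u} M) (f : ∀ i, X ⟶ Z i), (∀ i, P (Z i)) →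
      ∃ (Y : Action TopCat.{u} M) (e : X ⟶ Y) (m : ∀ i, Y ⟶ Z i),
        P Y ∧ DenseRange e.hom ∧ ∀ i, e ≫ m i = f i) :
    HasUniversalArrow P X := by
  obtain ⟨J, B, b, h⟩ := exists_small_topCat X.V
  refine .of_factorization P X (fun Y e => T2Space Y ∧ DenseRange e) ?_ ?_
    ⟨J, B, b, fun Y e he => h Y e (have := he.1; exists_injective_of_denseRange he.2)⟩
  · intro I Z f hZ
    obtain ⟨Y, e, m, hY, he, hm⟩ := factor I Z f hZ
    exact ⟨Y, e, m, hY, ⟨hP Y hY, he⟩, hm⟩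
  · intro Y e he Z hZ a a' haa'
    have := hP Z hZ
    have : (a : Y → Z.V) = a' := he.2.equalizer a.hom.continuous a'.hom.continuous
      (funext fun x => ConcreteCategory.congr_hom haa' x)
    ext y
    exact congrFun this y

theorem hom_topAct {X Y : Action TopCat.{u} M} (f : X ⟶ Y) (m : M) (x : X.V) :
    f.hom (topAct X m x) = topAct Y m (f.hom x) :=
  ConcreteCategory.congr_hom (f.comm m) x

theorem continuous_topAct (X : Action TopCat.{u} M) (m : M) : Continuous (topAct X m) :=
  (ConcreteCategory.hom (X.ρ m : X.V ⟶ X.V)).continuous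

/-- The flow on an invariant subspace of a product of flows. -/
def topSubFlow {I : Type u} (Z : I → Action TopCat.{u} M) (A : Set (∀ i, (Z i).V))
    (hA : ∀ (m : M), ∀ z ∈ A, (fun i => topAct (Z i) m (z i)) ∈ A) : Action TopCat.{u} M where
  V := TopCat.of A
  ρ :=
    { toFun := fun m => TopCat.ofHom ⟨fun z => ⟨_, hA m z z.2⟩, by
        refine Continuous.subtype_mk (continuous_pi fun i => ?_) _
        exact (continuous_topAct (Z i) m).comp ((continuous_apply i).comp continuous_subtype_val)⟩
      map_one' := by
        apply ConcreteCategory.hom_ext (C := TopCat)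
        intro z
        exact Subtype.ext (funext fun i => topAct_one (Z i) (z.1 i))
      map_mul' := fun m n => by
        apply ConcreteCategory.hom_ext (C := TopCat)
        intro z
        exact Subtype.ext (funext fun i => topAct_mul (Z i) m n (z.1 i)) }

theorem exists_topSubFlow {X : Action TopCat.{u} M} {I : Type u} (Z : I → Action TopCat.{u} M)
    (f : ∀ i, X ⟶ Z i) (A : Set (∀ i, (Z i).V))
    (hA : ∀ (m : M), ∀ z ∈ A, (fun i => topAct (Z i) m (z i)) ∈ A)
    (hf : ∀ x, (fun i => (f i).hom x) ∈ A) :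
    ∃ (Y : Action TopCat.{u} M) (e : X ⟶ Y) (m : ∀ i, Y ⟶ Z i),
      (∀ i, e ≫ m i = f i) ∧ IsEmbedding (fun y i => (m i).hom y) ∧
      Set.range (fun y i => (m i).hom y) = A := by
  refine ⟨topSubFlow Z A hA,
    { hom := TopCat.ofHom ⟨fun x => ⟨_, hf x⟩, ?_⟩, comm := ?_ },
    fun i => { hom := TopCat.ofHom ⟨fun z => z.1 i, ?_⟩, comm := ?_ }, ?_, ?_, ?_⟩
  · exact Continuous.subtype_mk (continuous_pi fun i => (f i).hom.hom.continuous) _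
  · intro m
    ext x
    exact Subtype.ext (funext fun i => hom_topAct (f i) m x)
  · exact (continuous_apply i).comp continuous_subtype_val
  · exact fun m => rfl
  · exact fun i => rfl
  · exact IsEmbedding.subtypeVal
  · exact Subtype.range_coe

theorem exists_surjective_topSubFlow {X : Action TopCat.{u} M} {I : Type u}
    (Z : I → Action TopCat.{u} M) (f : ∀ i, X ⟶ Z i) :
    ∃ (Y : Action TopCat.{u} M) (e : X ⟶ Y) (m : ∀ i, Y ⟶ Z i),
      (∀ i, e ≫ m i = f i) ∧ IsEmbedding (fun y i => (m i).hom y) ∧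
      Function.Surjective e.hom := by
  obtain ⟨Y, e, m, hm, hemb, hr⟩ := exists_topSubFlow Z f (Set.range fun x i => (f i).hom x) (by
    rintro m _ ⟨x, rfl⟩
    exact ⟨topAct X m x, funext fun i => hom_topAct (f i) m x⟩) fun x => ⟨x, rfl⟩
  refine ⟨Y, e, m, hm, hemb, fun y => ?_⟩
  obtain ⟨x, hx⟩ := hr.subset ⟨y, rfl⟩
  refine ⟨x, hemb.injective (Eq.trans ?_ hx)⟩
  funext i
  exact ConcreteCategory.congr_hom (congrArg Action.Hom.hom (hm i)) x

theorem exists_denseRange_topSubFlow {X : Action TopCat.{u} M} {I : Type u}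
    (Z : I → Action TopCat.{u} M) (f : ∀ i, X ⟶ Z i) :
    ∃ (Y : Action TopCat.{u} M) (e : X ⟶ Y) (m : ∀ i, Y ⟶ Z i),
      (∀ i, e ≫ m i = f i) ∧ IsClosedEmbedding (fun y i => (m i).hom y) ∧
      DenseRange e.hom := by
  let F : X.V → ∀ i, (Z i).V := fun x i => (f i).hom x
  obtain ⟨Y, e, m, hm, hemb, hr⟩ := exists_topSubFlow Z f (closure (Set.range F)) (by
    intro m
    let φ : (∀ i, (Z i).V) → ∀ i, (Z i).V := fun z i => topAct (Z i) m (z i)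
    -- Each element of `M` acts continuously on the product, so the closure of an invariant set is
    -- invariant.
    have hφ : Continuous φ :=
      continuous_pi fun i => (continuous_topAct (Z i) m).comp (continuous_apply i)
    refine fun z hz => map_mem_closure (f := φ) hφ hz ?_
    rintro _ ⟨x, rfl⟩
    exact ⟨topAct X m x, funext fun i => hom_topAct (f i) m x⟩)
    fun x => subset_closure ⟨x, rfl⟩
  refine ⟨Y, e, m, hm, ⟨hemb, hr ▸ isClosed_closure⟩, fun y => ?_⟩
  rw [hemb.isInducing.closure_eq_preimage_closure_image, ← Set.range_comp]
  have : (fun y i => (m i).hom y) ∘ e.hom = F := funext fun x => funext fun i =>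
    ConcreteCategory.congr_hom (congrArg Action.Hom.hom (hm i)) x
  rw [this]
  exact hr.subset ⟨y, rfl⟩

theorem TopClass.prop_of_isEmbedding {C : TopClass} (hC : C ≠ .compactT2) {I : Type u}
    {Z : I → TopCat.{u}} (hZ : ∀ i, C.prop (Z i)) {Y : TopCat.{u}} {j : Y → ∀ i, Z i}
    (hj : IsEmbedding j) : C.prop Y := by
  cases C with
  | blank => trivial
  | T0 => have (i : I) : T0Space (Z i) := hZ i; exact hj.t0Space
  | T1 => have (i : I) : T1Space (Z i) := hZ i; exact hj.t1Space
  | T2 => have (i : I) : T2Space (Z i) := hZ i; exact hj.t2Space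
  | functionallyT2 =>
    intro x y hxy
    obtain ⟨i, hi⟩ := Function.ne_iff.1 (hj.injective.ne hxy)
    obtain ⟨f, hf, hne⟩ := hZ i _ _ hi
    exact ⟨fun y => f (j y i), hf.comp ((continuous_apply i).comp hj.continuous), hne⟩
  | tychonoff => have (i : I) : T35Space (Z i) := hZ i; exact hj.t35Space
  | compactT2 => exact absurd rfl hC

/-- The hypothesis on `F` says that the constraint passes to initial topologies. Compactness is not
inherited by arbitrary subspaces, so only that class needs the closure of the image; all other
classes use the image itself. -/
theorem hasUniversalArrow_top {F : ObjectProperty (Action TopCat.{u} M)}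
    (hF : ∀ (Y : Action TopCat.{u} M) (I : Type u) (Z : I → Action TopCat.{u} M)
      (m : ∀ i, Y ⟶ Z i), IsInducing (fun y i => (m i).hom y) → (∀ i, F (Z i)) → F Y)
    (C : TopClass) (X : Action TopCat.{u} M) :
    HasUniversalArrow (fun Y => C.prop Y.V ∧ F Y) X := by
  by_cases hC : C = .compactT2
  · subst hC
    refine .of_denseRange_factorization_top _ (fun Y hY => hY.1.2) X fun I Z f hZ => ?_
    obtain ⟨Y, e, m, hm, hj, he⟩ := exists_denseRange_topSubFlow Z f
    have (i : I) : CompactSpace (Z i).V := (hZ i).1.1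
    have (i : I) : T2Space (Z i).V := (hZ i).1.2
    exact ⟨Y, e, m, ⟨⟨hj.compactSpace, hj.isEmbedding.t2Space⟩,
      hF Y I Z m hj.isInducing fun i => (hZ i).2⟩, he, hm⟩
  · refine .of_surjective_factorization_top _ X fun I Z f hZ => ?_
    obtain ⟨Y, e, m, hm, hj, he⟩ := exists_surjective_topSubFlow Z f
    exact ⟨Y, e, m, ⟨TopClass.prop_of_isEmbedding hC (fun i => (hZ i).1) hj,
      hF Y I Z m hj.isInducing fun i => (hZ i).2⟩, he, hm⟩

end Top
/-! ### Flows on topological spaces -/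

section Top

variable {M : Type v} [Monoid M]

theorem hasUniversalArrow_topFlows [TopologicalSpace M] (𝒮 𝒥 : Set (Set M)) (C : TopClass)
    (X : Action TopCat.{u} M) : HasUniversalArrow (topFlows M 𝒮 𝒥 C) X := by
  refine hasUniversalArrow_top (fun Y I Z m hm hZ => ⟨fun S hS x => ?_, fun J hJ => ?_⟩) C X
  · refine hm.continuous_iff.2 (continuous_pi fun i => ?_)
    simpa only [Function.comp_apply, hom_topAct] using (hZ i).1 S hS ((m i).hom x)
  · refine hm.continuous_iff.2 (continuous_pi fun i => ?_)
    simp only [Function.comp_apply, hom_topAct]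
    exact ((hZ i).2 J hJ).comp
      (continuous_id.prodMap (ConcreteCategory.hom (m i).hom).continuous)

/-! ### Flows on compactly generated spaces -/

/-- This is the universal property of the coreflection `κ`: apply `κ` to the composite into `Y`,
then precompose with the map from `X` to its own refinement, continuous since `X` is compactly
generated. -/
theorem continuous_compactCoherentification_rng {X : Type*} {Y : Type*} [TopologicalSpace X]
    [TopologicalSpace Y] [CompactlyCoherentSpace X] {f : X → CompactCoherentification Y}
    (hf : Continuous ((CompactCoherentification.mk Y).symm ∘ f)) : Continuous f :=
  (CompactCoherentification.continuous_map_of_continuous hf).comp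
    CompactCoherentification.continuous_mk

/-- The flow induced on the compactly generated refinement. -/
noncomputable def kFlow (Y : Action TopCat.{u} M) : Action TopCat.{u} M where
  V := TopCat.of (CompactCoherentification Y.V)
  ρ :=
    { toFun := fun m => TopCat.ofHom ⟨CompactCoherentification.map (topAct Y m),
        CompactCoherentification.continuous_map_of_continuous (continuous_topAct Y m)⟩
      map_one' := by
        apply ConcreteCategory.hom_ext (C := TopCat)
        intro z
        exact topAct_one Y z
      map_mul' := fun m n => by
        apply ConcreteCategory.hom_ext (C := TopCat)
        intro z
        exact topAct_mul Y m n z }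

/-- The identity map from the compactly generated refinement. -/
noncomputable def kFlowCounit (Y : Action TopCat.{u} M) : kFlow Y ⟶ Y where
  hom := TopCat.ofHom ⟨(CompactCoherentification.mk Y.V).symm,
    CompactCoherentification.continuous_mk_symm⟩
  comm _ := rfl

/-- Equivariant maps from compactly generated spaces factor through the refinement. -/
noncomputable def kFlowLift {X Y : Action TopCat.{u} M} [CompactlyCoherentSpace X.V] (e : X ⟶ Y) :
    X ⟶ kFlow Y where
  hom := TopCat.ofHom ⟨CompactCoherentification.mk Y.V ∘ e.hom,
    continuous_compactCoherentification_rng (ConcreteCategory.hom e.hom).continuous⟩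
  comm m := by
    ext x
    exact hom_topAct e m x

/-- The constraint of `kFlows` on the action. -/
def KFlowContinuous [TopologicalSpace M] (𝒮 𝒥 : Set (Set M)) (X : Action TopCat.{u} M) : Prop :=
  (∀ S ∈ 𝒮, ∀ x : X.V, KContinuous fun s : S => topAct X (s : M) x) ∧
  (∀ J ∈ 𝒥, KContinuous fun p : CompactCoherentification J × X.V =>
    topAct X (((CompactCoherentification.mk J).symm p.1 : J) : M) p.2)

/-- The domains in both conditions are themselves `κ`-refinements, so continuity into the refined
space can be tested in `Y`, and from there in each coordinate `Z i`. -/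
theorem KFlowContinuous.kFlow [TopologicalSpace M] {𝒮 𝒥 : Set (Set M)} {Y : Action TopCat.{u} M}
    {I : Type u} {Z : I → Action TopCat.{u} M} (m : ∀ i, Y ⟶ Z i)
    (hm : IsInducing (fun y i => (m i).hom y)) (hZ : ∀ i, KFlowContinuous 𝒮 𝒥 (Z i)) :
    KFlowContinuous 𝒮 𝒥 (kFlow Y) := by
  refine ⟨fun S hS x => ?_, fun J hJ => ?_⟩
  · refine continuous_compactCoherentification_rng (Y := Y.V)
      (hm.continuous_iff.2 (continuous_pi fun i => ?_))
    refine ((hZ i).1 S hS ((kFlowCounit Y ≫ m i).hom x)).congr fun s => ?_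
    exact (hom_topAct (kFlowCounit Y ≫ m i) _ x).symm
  · refine continuous_compactCoherentification_rng (Y := Y.V)
      (hm.continuous_iff.2 (continuous_pi fun i => ?_))
    let q : CompactCoherentification J × (FlowCat.kFlow Y).V →
        CompactCoherentification J × (Z i).V :=
      Prod.map id (kFlowCounit Y ≫ m i).hom
    have hq : Continuous q := continuous_id.prodMap
      (ConcreteCategory.hom (kFlowCounit Y ≫ m i).hom).continuous
    refine (((hZ i).2 J hJ).comp
      (CompactCoherentification.continuous_map_of_continuous hq)).congr fun p => ?_
    exact (hom_topAct (kFlowCounit Y ≫ m i) _ _).symm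

theorem hasUniversalArrow_kFlows [TopologicalSpace M] (𝒮 𝒥 : Set (Set M)) (C : KTopClass)
    (X : Action TopCat.{u} M) (hX : kFlows M 𝒮 𝒥 .blank X) :
    HasUniversalArrow (kFlows M 𝒮 𝒥 C) X := by
  have : CompactlyCoherentSpace X.V := hX.1
  cases C with
  | blank => exact .of_prop hX
  | T2 =>
    refine .of_surjective_factorization_top _ X fun I Z f hZ => ?_
    obtain ⟨Y, e, m, hm, hj, he⟩ := exists_surjective_topSubFlow Z f
    have (i : I) : T2Space (Z i).V := (hZ i).1.2
    have : T2Space Y.V := hj.t2Space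
    exact ⟨kFlow Y, kFlowLift e, fun i => kFlowCounit Y ≫ m i,
      ⟨⟨CompactCoherentification.instCompactlyCoherentSpace (X := Y.V),
        CompactCoherentification.t2space (X := Y.V)⟩,
        KFlowContinuous.kFlow m hj.isInducing fun i => (hZ i).2⟩,
      (CompactCoherentification.mk Y.V).surjective.comp he, hm⟩
  | compactT2 =>
    refine .of_denseRange_factorization_top _ (fun Y hY => hY.1.2.2) X fun I Z f hZ => ?_
    obtain ⟨Y, e, m, hm, hj, he⟩ := exists_denseRange_topSubFlow Z f
    have (i : I) : CompactSpace (Z i).V := (hZ i).1.2.1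
    have (i : I) : T2Space (Z i).V := (hZ i).1.2.2
    have : T2Space Y.V := hj.isEmbedding.t2Space
    have : CompactSpace Y.V := hj.compactSpace
    -- A compact space is already compactly generated, so refining loses neither compactness nor
    -- density of the image.
    let φ : Y.V ≃ₜ CompactCoherentification Y.V := CompactCoherentification.homeo
    exact ⟨kFlow Y, kFlowLift e, fun i => kFlowCounit Y ≫ m i,
      ⟨⟨CompactCoherentification.instCompactlyCoherentSpace (X := Y.V), φ.compactSpace,
        CompactCoherentification.t2space (X := Y.V)⟩,
        KFlowContinuous.kFlow m hj.isInducing fun i => (hZ i).2⟩,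
      φ.surjective.denseRange.comp he φ.continuous, hm⟩

end Top

/-! ### Flows on uniform spaces -/

section Unif

variable {M : Type v} [Monoid M]

theorem unifAct_one (X : Action UniformSpaceCat.{u} M) (x : X.V) : unifAct X 1 x = x :=
  ConcreteCategory.congr_hom X.ρ.map_one x

theorem unifAct_mul (X : Action UniformSpaceCat.{u} M) (m n : M) (x : X.V) :
    unifAct X (m * n) x = unifAct X m (unifAct X n x) :=
  ConcreteCategory.congr_hom (X.ρ.map_mul m n) x

theorem hom_unifAct {X Y : Action UniformSpaceCat.{u} M} (f : X ⟶ Y) (m : M) (x : X.V) :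
    f.hom (unifAct X m x) = unifAct Y m (f.hom x) :=
  ConcreteCategory.congr_hom (f.comm m) x

theorem uniformContinuous_hom {X Y : UniformSpaceCat.{u}} (f : X ⟶ Y) : UniformContinuous f :=
  (ConcreteCategory.hom f).2

theorem uniformContinuous_unifAct (X : Action UniformSpaceCat.{u} M) (m : M) :
    UniformContinuous (unifAct X m) :=
  uniformContinuous_hom (X.ρ m : X.V ⟶ X.V)

theorem HasUniversalArrow.of_surjective_factorization_unif
    (P : ObjectProperty (Action UniformSpaceCat.{u} M)) (X : Action UniformSpaceCat.{u} M)
    (factor : ∀ (I : Type u) (Z : I → Action UniformSpaceCat.{u} M) (f : ∀ i, X ⟶ Z i),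
      (∀ i, P (Z i)) → ∃ (Y : Action UniformSpaceCat.{u} M) (e : X ⟶ Y) (m : ∀ i, Y ⟶ Z i),
        P Y ∧ Function.Surjective e.hom ∧ ∀ i, e ≫ m i = f i) :
    HasUniversalArrow P X := by
  obtain ⟨J, B, b, h⟩ := exists_small_uniformSpaceCat X.V
  refine .of_factorization P X (fun _ e => Function.Surjective e) factor ?_
    ⟨J, B, b, fun Y e he => h Y e (exists_injective_of_surjective he)⟩
  intro Y e he Z _ a a' haa'
  apply ConcreteCategory.hom_ext
  intro y
  obtain ⟨x, rfl⟩ := he y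
  exact ConcreteCategory.congr_hom haa' x

theorem HasUniversalArrow.of_denseRange_factorization_unif
    (P : ObjectProperty (Action UniformSpaceCat.{u} M)) (hP : ∀ Y, P Y → T2Space Y.V)
    (X : Action UniformSpaceCat.{u} M)
    (factor : ∀ (I : Type u) (Z : I → Action UniformSpaceCat.{u} M) (f : ∀ i, X ⟶ Z i),
      (∀ i, P (Z i)) → ∃ (Y : Action UniformSpaceCat.{u} M) (e : X ⟶ Y) (m : ∀ i, Y ⟶ Z i),
        P Y ∧ DenseRange e.hom ∧ ∀ i, e ≫ m i = f i) :
    HasUniversalArrow P X := by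
  obtain ⟨J, B, b, h⟩ := exists_small_uniformSpaceCat X.V
  refine .of_factorization P X (fun Y e => T2Space Y ∧ DenseRange e) ?_ ?_
    ⟨J, B, b, fun Y e he => h Y e (have := he.1; exists_injective_of_denseRange he.2)⟩
  · intro I Z f hZ
    obtain ⟨Y, e, m, hY, he, hm⟩ := factor I Z f hZ
    exact ⟨Y, e, m, hY, ⟨hP Y hY, he⟩, hm⟩
  · intro Y e he Z hZ a a' haa'
    have := hP Z hZ
    exact UniformSpaceCat.hom_ext (he.2.equalizer (uniformContinuous_hom a).continuous
      (uniformContinuous_hom a').continuous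
      (funext fun x => ConcreteCategory.congr_hom haa' x))

/-- The flow on an invariant subspace of a product of uniform flows. -/
def unifSubFlow {I : Type u} (Z : I → Action UniformSpaceCat.{u} M) (A : Set (∀ i, (Z i).V))
    (hA : ∀ (m : M), ∀ z ∈ A, (fun i => unifAct (Z i) m (z i)) ∈ A) :
    Action UniformSpaceCat.{u} M where
  V := UniformSpaceCat.of A
  ρ :=
    { toFun := fun m => UniformSpaceCat.ofHom ⟨fun z => ⟨_, hA m z z.2⟩, by
        refine UniformContinuous.subtype_mk (uniformContinuous_pi.2 fun i => ?_) _
        exact (uniformContinuous_unifAct (Z i) m).comp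
          ((Pi.uniformContinuous_proj _ i).comp uniformContinuous_subtype_val)⟩
      map_one' := by
        apply UniformSpaceCat.hom_ext
        funext z
        exact Subtype.ext (funext fun i => unifAct_one (Z i) (z.1 i))
      map_mul' := fun m n => by
        apply UniformSpaceCat.hom_ext
        funext z
        exact Subtype.ext (funext fun i => unifAct_mul (Z i) m n (z.1 i)) }

theorem exists_unifSubFlow {X : Action UniformSpaceCat.{u} M} {I : Type u}
    (Z : I → Action UniformSpaceCat.{u} M)
    (f : ∀ i, X ⟶ Z i) (A : Set (∀ i, (Z i).V))
    (hA : ∀ (m : M), ∀ z ∈ A, (fun i => unifAct (Z i) m (z i)) ∈ A)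
    (hf : ∀ x, (fun i => (f i).hom x) ∈ A) :
    ∃ (Y : Action UniformSpaceCat.{u} M) (e : X ⟶ Y) (m : ∀ i, Y ⟶ Z i),
      (∀ i, e ≫ m i = f i) ∧ IsUniformEmbedding (fun y i => (m i).hom y) ∧
      Set.range (fun y i => (m i).hom y) = A := by
  refine ⟨unifSubFlow Z A hA,
    { hom := UniformSpaceCat.ofHom ⟨fun x => ⟨_, hf x⟩, ?_⟩, comm := ?_ },
    fun i => { hom := UniformSpaceCat.ofHom ⟨fun z => z.1 i, ?_⟩, comm := ?_ }, ?_, ?_, ?_⟩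
  · exact UniformContinuous.subtype_mk
      (uniformContinuous_pi.2 fun i => uniformContinuous_hom (f i).hom) _
  · intro m
    apply UniformSpaceCat.hom_ext
    funext x
    exact Subtype.ext (funext fun i => hom_unifAct (f i) m x)
  · exact (Pi.uniformContinuous_proj _ i).comp uniformContinuous_subtype_val
  · exact fun m => rfl
  · exact fun i => rfl
  · exact isUniformEmbedding_subtype_val
  · exact Subtype.range_coe

theorem exists_surjective_unifSubFlow {X : Action UniformSpaceCat.{u} M} {I : Type u}
    (Z : I → Action UniformSpaceCat.{u} M) (f : ∀ i, X ⟶ Z i) :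
    ∃ (Y : Action UniformSpaceCat.{u} M) (e : X ⟶ Y) (m : ∀ i, Y ⟶ Z i),
      (∀ i, e ≫ m i = f i) ∧ IsUniformEmbedding (fun y i => (m i).hom y) ∧
      Function.Surjective e.hom := by
  obtain ⟨Y, e, m, hm, hemb, hr⟩ := exists_unifSubFlow Z f (Set.range fun x i => (f i).hom x) (by
    rintro m _ ⟨x, rfl⟩
    exact ⟨unifAct X m x, funext fun i => hom_unifAct (f i) m x⟩) fun x => ⟨x, rfl⟩
  refine ⟨Y, e, m, hm, hemb, fun y => ?_⟩
  obtain ⟨x, hx⟩ := hr.subset ⟨y, rfl⟩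
  refine ⟨x, hemb.injective (Eq.trans ?_ hx)⟩
  funext i
  exact ConcreteCategory.congr_hom (congrArg Action.Hom.hom (hm i)) x

theorem exists_denseRange_unifSubFlow {X : Action UniformSpaceCat.{u} M} {I : Type u}
    (Z : I → Action UniformSpaceCat.{u} M) (f : ∀ i, X ⟶ Z i) :
    ∃ (Y : Action UniformSpaceCat.{u} M) (e : X ⟶ Y) (m : ∀ i, Y ⟶ Z i),
      (∀ i, e ≫ m i = f i) ∧ IsUniformEmbedding (fun y i => (m i).hom y) ∧
      IsClosed (Set.range (fun y i => (m i).hom y)) ∧ DenseRange e.hom := by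
  let F : X.V → ∀ i, (Z i).V := fun x i => (f i).hom x
  obtain ⟨Y, e, m, hm, hemb, hr⟩ := exists_unifSubFlow Z f (closure (Set.range F)) (by
    intro m
    let φ : (∀ i, (Z i).V) → ∀ i, (Z i).V := fun z i => unifAct (Z i) m (z i)
    have hφ : Continuous φ := continuous_pi fun i =>
      (uniformContinuous_unifAct (Z i) m).continuous.comp (continuous_apply i)
    refine fun z hz => map_mem_closure (f := φ) hφ hz ?_
    rintro _ ⟨x, rfl⟩
    exact ⟨unifAct X m x, funext fun i => hom_unifAct (f i) m x⟩)
    fun x => subset_closure ⟨x, rfl⟩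
  refine ⟨Y, e, m, hm, hemb, hr ▸ isClosed_closure, fun y => ?_⟩
  rw [hemb.isEmbedding.isInducing.closure_eq_preimage_closure_image, ← Set.range_comp]
  have : (fun y i => (m i).hom y) ∘ e.hom = F := funext fun x => funext fun i =>
    ConcreteCategory.congr_hom (congrArg Action.Hom.hom (hm i)) x
  rw [this]
  exact hr.subset ⟨y, rfl⟩

/-- As in the topological case, now with initial uniformities. In the complete and compact cases the
image closure is closed in the product, hence inherits the property. -/
theorem hasUniversalArrow_unif {F : ObjectProperty (Action UniformSpaceCat.{u} M)}
    (hF : ∀ (Y : Action UniformSpaceCat.{u} M) (I : Type u) (Z : I → Action UniformSpaceCat.{u} M)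
      (m : ∀ i, Y ⟶ Z i), IsUniformInducing (fun y i => (m i).hom y) → (∀ i, F (Z i)) → F Y)
    (C : UnifClass) (X : Action UniformSpaceCat.{u} M) (hX : F X) :
    HasUniversalArrow (fun Y => C.prop Y.V ∧ F Y) X := by
  cases C with
  | blank => exact .of_prop ⟨trivial, hX⟩
  | T2 =>
    refine .of_surjective_factorization_unif _ X fun I Z f hZ => ?_
    obtain ⟨Y, e, m, hm, hj, he⟩ := exists_surjective_unifSubFlow Z f
    have (i : I) : T2Space (Z i).V := (hZ i).1
    exact ⟨Y, e, m, ⟨hj.isEmbedding.t2Space,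
      hF Y I Z m hj.isUniformInducing fun i => (hZ i).2⟩, he, hm⟩
  | completeT2 =>
    refine .of_denseRange_factorization_unif _ (fun Y hY => hY.1.2) X fun I Z f hZ => ?_
    obtain ⟨Y, e, m, hm, hj, hc, he⟩ := exists_denseRange_unifSubFlow Z f
    have (i : I) : CompleteSpace (Z i).V := (hZ i).1.1
    have (i : I) : T2Space (Z i).V := (hZ i).1.2
    exact ⟨Y, e, m, ⟨⟨(completeSpace_iff_isComplete_range hj.isUniformInducing).2 hc.isComplete,
      hj.isEmbedding.t2Space⟩, hF Y I Z m hj.isUniformInducing fun i => (hZ i).2⟩, he, hm⟩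
  | compactT2 =>
    refine .of_denseRange_factorization_unif _ (fun Y hY => hY.1.2) X fun I Z f hZ => ?_
    obtain ⟨Y, e, m, hm, hj, hc, he⟩ := exists_denseRange_unifSubFlow Z f
    have (i : I) : CompactSpace (Z i).V := (hZ i).1.1
    have (i : I) : T2Space (Z i).V := (hZ i).1.2
    exact ⟨Y, e, m, ⟨⟨(IsClosedEmbedding.mk hj.isEmbedding hc).compactSpace,
      hj.isEmbedding.t2Space⟩, hF Y I Z m hj.isUniformInducing fun i => (hZ i).2⟩, he, hm⟩

theorem hasUniversalArrow_unifFlows [UniformSpace M] (𝒮 𝒥 : Set (Set M)) (C : UnifClass)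
    (X : Action UniformSpaceCat.{u} M) (hX : unifFlows M 𝒮 𝒥 .blank X) :
    HasUniversalArrow (unifFlows M 𝒮 𝒥 C) X := by
  refine hasUniversalArrow_unif (fun Y I Z m hm hZ => ⟨fun S hS x => ?_, fun J hJ => ?_⟩) C X hX.2
  · refine hm.uniformContinuous_iff.2 (uniformContinuous_pi.2 fun i => ?_)
    simpa only [Function.comp_apply, hom_unifAct] using (hZ i).1 S hS ((m i).hom x)
  · refine hm.uniformContinuous_iff.2 (uniformContinuous_pi.2 fun i => ?_)
    simp only [Function.comp_apply, hom_unifAct]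
    exact ((hZ i).2 J hJ).comp (uniformContinuous_id.prodMap (uniformContinuous_hom (m i).hom))

/-- Boundedness and quasi-boundedness are both convergence statements towards the uniformity of the
space; this lets such convergence be checked coordinatewise. -/
theorem tendsto_uniformity_of_isUniformInducing {X ι T : Type*} {Y : ι → Type*} [UniformSpace X]
    [∀ i, UniformSpace (Y i)] {j : X → ∀ i, Y i} (hj : IsUniformInducing j) {l : Filter T}
    {h : T → X × X}
    (H : ∀ i, Filter.Tendsto (fun t => (j (h t).1 i, j (h t).2 i)) l (𝓤 (Y i))) :
    Filter.Tendsto h l (𝓤 X) := by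
  rw [← hj.comap_uniformity, Filter.tendsto_comap_iff, Pi.uniformity, Filter.tendsto_iInf]
  exact fun i => Filter.tendsto_comap_iff.2 (H i)

theorem hasUniversalArrow_boundedFlows {G : Type v} [Group G] [TopologicalSpace G] (C : UnifClass)
    (X : Action UniformSpaceCat.{u} G) (hX : boundedFlows G .blank X) :
    HasUniversalArrow (boundedFlows G C) X := by
  have key (Y : Action UniformSpaceCat.{u} G) :
      (∀ V ∈ 𝓤 Y.V, ∃ N ∈ 𝓝 (1 : G), ∀ s ∈ N, ∀ y : Y.V, (unifAct Y s y, y) ∈ V) ↔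
      Filter.Tendsto (fun p : G × Y.V => (unifAct Y p.1 p.2, p.2)) (𝓝 1 ×ˢ ⊤) (𝓤 Y.V) := by
    simp only [Filter.tendsto_def, Filter.mem_prod_top]
    refine forall₂_congr fun V _ => ⟨fun ⟨N, hN, h⟩ => ?_, fun h => ⟨_, h, fun s hs y => hs y⟩⟩
    exact Filter.mem_of_superset hN h
  refine hasUniversalArrow_unif (fun Y I Z m hm hZ => ?_) C X hX.2
  rw [key]
  refine tendsto_uniformity_of_isUniformInducing hm fun i => ?_
  simp only [hom_unifAct]
  exact ((key _).1 (hZ i)).comp (Filter.tendsto_id.prodMap Filter.tendsto_top)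

theorem hasUniversalArrow_quasiBoundedFlows {G : Type v} [Group G] [TopologicalSpace G]
    (C : UnifClass) (X : Action UniformSpaceCat.{u} G) (hX : quasiBoundedFlows G .blank X) :
    HasUniversalArrow (quasiBoundedFlows G C) X := by
  have key (Y : Action UniformSpaceCat.{u} G) :
      (∀ W ∈ 𝓤 Y.V, ∃ N ∈ 𝓝 (1 : G), ∃ V ∈ 𝓤 Y.V,
        ∀ s ∈ N, ∀ x y : Y.V, (x, y) ∈ V → (unifAct Y s x, unifAct Y s y) ∈ W) ↔
      -- Quasi-boundedness is convergence along `𝓝 1` times the uniformity; boundedness uses `⊤` on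
      -- the space instead.
      Filter.Tendsto (fun p : G × Y.V × Y.V => (unifAct Y p.1 p.2.1, unifAct Y p.1 p.2.2))
        (𝓝 1 ×ˢ 𝓤 Y.V) (𝓤 Y.V) := by
    simp only [Filter.tendsto_def, Filter.mem_prod_iff]
    refine forall₂_congr fun W _ => exists_congr fun N => and_congr_right fun _ =>
      exists_congr fun V => and_congr_right fun _ => ?_
    exact ⟨fun h p hp => h p.1 hp.1 p.2.1 p.2.2 hp.2,
      fun h s hs x y hxy => h (Set.mk_mem_prod hs hxy)⟩
  refine hasUniversalArrow_unif (fun Y I Z m hm hZ => ?_) C X hX.2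
  rw [key]
  refine tendsto_uniformity_of_isUniformInducing hm fun i => ?_
  simp only [hom_unifAct]
  exact ((key _).1 (hZ i)).comp (Filter.tendsto_id.prodMap (uniformContinuous_hom (m i).hom))

end Unif
/-! ### Compact Hausdorff spaces and flows among uniform ones -/

/-- Reflectivity from universal arrows to the objects isomorphic to objects in the image. -/
theorem nonempty_reflective_of_hasUniversalArrow {𝓐 : Type*} [Category 𝓐] {𝓔 : Type*} [Category 𝓔]
    {P Q : ObjectProperty 𝓔} (F : 𝓐 ⥤ Q.FullSubcategory) [F.Full] [F.Faithful]
    (hP : ∀ A, P (F.obj A).obj) (hF : ∀ Y, P Y → ∃ A, Nonempty (Y ≅ (F.obj A).obj))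
    (h : ∀ X, Q X → HasUniversalArrow P X) : Nonempty (Reflective F) := by
  refine nonempty_reflective F fun X => ?_
  obtain ⟨R, hR, η, hη⟩ := h X.obj X.property
  obtain ⟨A, ⟨φ⟩⟩ := hF R hR
  refine ⟨A, ObjectProperty.homMk (η ≫ φ.hom), fun Z f => ?_⟩
  obtain ⟨g, hg, hu⟩ := hη _ (hP Z) f.hom
  -- The universal object `R` is replaced by the isomorphic image of `A`, and fullness turns the
  -- factorization into a morphism of the source category.
  refine ⟨F.preimage (ObjectProperty.homMk (φ.inv ≫ g)), ?_, fun k hk => F.map_injective ?_⟩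
  · apply ObjectProperty.hom_ext
    change (η ≫ φ.hom) ≫ (F.map (F.preimage _)).hom = f.hom
    rw [F.map_preimage]
    change (η ≫ φ.hom) ≫ φ.inv ≫ g = f.hom
    simpa using hg
  · rw [F.map_preimage]
    apply ObjectProperty.hom_ext
    change (F.map k).hom = φ.inv ≫ g
    rw [Iso.eq_inv_comp]
    refine hu _ ((Category.assoc _ _ _).symm.trans ?_)
    exact congrArg (fun t => t.hom) hk

/-- A compact Hausdorff uniform space carries the unique uniformity of its topology. -/
noncomputable def compactUnifIso (Y : UniformSpaceCat.{u}) [CompactSpace Y] [T2Space Y] :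
    Y ≅ compactUnif Y :=
  have h : uniformSpaceOfCompactR1 (γ := Y) = Y.str := unique_uniformity_of_compact rfl rfl
  { hom := ⟨⟨fun y => y, by
      change @UniformContinuous Y Y Y.str uniformSpaceOfCompactR1 _
      rw [h]; exact uniformContinuous_id⟩⟩
    inv := ⟨⟨fun y => y, by
      change @UniformContinuous Y Y uniformSpaceOfCompactR1 Y.str _
      rw [h]; exact uniformContinuous_id⟩⟩
    hom_inv_id := rfl
    inv_hom_id := rfl }

instance (D : UnifClass) : (compactToUnif.{u} D).Full where
  map_surjective {X Y} f :=
    have := X.property.1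
    have := X.property.2
    have := Y.property.1
    have := Y.property.2
    ⟨ObjectProperty.homMk (TopCat.ofHom ⟨f.hom, (uniformContinuous_hom f.hom).continuous⟩), rfl⟩

instance (D : UnifClass) : (compactToUnif.{u} D).Faithful where
  map_injective {X Y} f g h := by
    apply ObjectProperty.hom_ext
    apply ConcreteCategory.hom_ext
    intro x
    exact ConcreteCategory.congr_hom
      (congrArg (fun t : (compactToUnif D).obj X ⟶ (compactToUnif D).obj Y => t.hom) h) x

theorem hasUniversalArrow_topClass (C : TopClass) (X : TopCat.{u}) :
    HasUniversalArrow C.prop X :=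
  .of_trivial (Q := topFlows PUnit.{1} ∅ ∅ C) (fun _ => by simp [topFlows])
    (hasUniversalArrow_topFlows _ _ C _)

theorem hasUniversalArrow_unifClass (C : UnifClass) (X : UniformSpaceCat.{u}) :
    HasUniversalArrow C.prop X :=
  .of_trivial (Q := unifFlows PUnit.{1} ∅ ∅ C) (fun _ => by simp [unifFlows])
    (hasUniversalArrow_unifFlows _ _ C _ (by simp [unifFlows, UnifClass.prop]))

theorem hasUniversalArrow_kTopClass (C : KTopClass) (X : TopCat.{u})
    (hX : KTopClass.blank.prop X) : HasUniversalArrow C.prop X :=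
  .of_trivial (Q := kFlows PUnit.{1} ∅ ∅ C) (fun _ => by simp [kFlows])
    (hasUniversalArrow_kFlows _ _ C _ (by simpa [kFlows] using hX))

theorem KTopClass.prop_blank {D : KTopClass} {X : TopCat.{u}} (h : D.prop X) :
    KTopClass.blank.prop X := by
  cases D with
  | blank => exact h
  | T2 => exact h.1
  | compactT2 => exact h.1

theorem nonempty_reflective_compactToUnif (D : UnifClass) :
    Nonempty (Reflective (compactToUnif.{u} D)) := by
  refine nonempty_reflective_of_hasUniversalArrow (P := UnifClass.compactT2.prop) _ (fun A => ?_)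
    (fun Y hY => ?_) fun X _ => hasUniversalArrow_unifClass _ X
  · have := A.property.1
    have := A.property.2
    exact compactUnif_prop A.obj .compactT2
  · have := hY.1
    have := hY.2
    exact ⟨⟨TopCat.of Y, hY⟩, ⟨compactUnifIso Y⟩⟩

/-! ### Continuous compact Hausdorff flows of a group as bounded uniform flows. -/

section Group

variable {G : Type v} [Group G] [TopologicalSpace G]

instance (D : UnifClass) : (compactFlowToBounded.{v, u} G D).Full where
  map_surjective {X Y} f :=
    have := X.property.1.1
    have := X.property.1.2
    have := Y.property.1.1
    have := Y.property.1.2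
    ⟨ObjectProperty.homMk
      { hom := TopCat.ofHom ⟨f.hom.hom, (uniformContinuous_hom f.hom.hom).continuous⟩
        comm := fun g => by
          apply ConcreteCategory.hom_ext
          intro x
          exact ConcreteCategory.congr_hom (f.hom.comm g) x }, rfl⟩

instance (D : UnifClass) : (compactFlowToBounded.{v, u} G D).Faithful where
  map_injective {X Y} f g h := by
    apply ObjectProperty.hom_ext
    apply Action.hom_ext
    apply ConcreteCategory.hom_ext
    intro x
    exact ConcreteCategory.congr_hom (congrArg (fun t : (compactFlowToBounded G D).obj X ⟶
      (compactFlowToBounded G D).obj Y => t.hom.hom) h) x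

/-- The topological flow underlying a uniform flow. -/
def unifFlowToTop (Y : Action UniformSpaceCat.{u} G) : Action TopCat.{u} G where
  V := TopCat.of Y.V
  ρ :=
    { toFun := fun g => TopCat.ofHom ⟨unifAct Y g, (uniformContinuous_unifAct Y g).continuous⟩
      map_one' := by
        apply ConcreteCategory.hom_ext (C := TopCat)
        exact unifAct_one Y
      map_mul' := fun g h => by
        apply ConcreteCategory.hom_ext (C := TopCat)
        exact unifAct_mul Y g h }

/-- Bounded flows of a topological group are jointly continuous. -/
theorem continuous_unifAct_of_bounded [IsTopologicalGroup G] (Y : Action UniformSpaceCat.{u} G)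
    (hY : ∀ V ∈ 𝓤 Y.V, ∃ N ∈ 𝓝 (1 : G), ∀ s ∈ N, ∀ y : Y.V, (unifAct Y s y, y) ∈ V) :
    Continuous fun p : G × Y.V => unifAct Y p.1 p.2 := by
  refine continuous_iff_continuousAt.2 fun ⟨g, y⟩ => ?_
  refine Uniform.tendsto_nhds_left.2 fun V hV => ?_
  obtain ⟨W, hW, hWV⟩ := comp_mem_uniformity_sets hV
  obtain ⟨N, hN, hNW⟩ := hY W hW
  -- Writing `p.1 = (p.1 * g⁻¹) * g` moves the question to the identity, where boundedness applies
  -- uniformly in the point; the intermediate point is `g` acting on `p.2`.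
  have h₁ : ∀ᶠ p : G × Y.V in 𝓝 (g, y), p.1 * g⁻¹ ∈ N := by
    have : Continuous fun p : G × Y.V => p.1 * g⁻¹ := by fun_prop
    exact this.continuousAt.eventually_mem (by simpa using hN)
  have h₂ : ∀ᶠ p : G × Y.V in 𝓝 (g, y), (unifAct Y g p.2, unifAct Y g y) ∈ W :=
    Uniform.tendsto_nhds_left.1 (((uniformContinuous_unifAct Y g).continuous.comp
      continuous_snd).tendsto (g, y)) hW
  change ∀ᶠ p : G × Y.V in 𝓝 (g, y), (unifAct Y p.1 p.2, unifAct Y g y) ∈ V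
  filter_upwards [h₁, h₂] with p hp₁ hp₂
  refine hWV ⟨unifAct Y g p.2, ?_, hp₂⟩
  have := hNW _ hp₁ (unifAct Y g p.2)
  rwa [← unifAct_mul, inv_mul_cancel_right] at this

theorem nonempty_reflective_compactFlowToBounded [IsTopologicalGroup G] (D : UnifClass) :
    Nonempty (Reflective (compactFlowToBounded.{v, u} G D)) := by
  refine nonempty_reflective_of_hasUniversalArrow (P := boundedFlows G .compactT2) _ (fun A => ?_)
    (fun Y hY => ?_) fun X hX => hasUniversalArrow_boundedFlows _ X ⟨trivial, hX.2⟩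
  · have := A.property.1.1
    have := A.property.1.2
    exact compactUnifFlow_bounded A.obj .compactT2 A.property
  · have := hY.1.1
    have := hY.1.2
    -- A bounded compact Hausdorff flow comes from its underlying topological flow; the underlying
    -- isomorphism is the identity, by uniqueness of the uniformity.
    refine ⟨⟨unifFlowToTop Y, hY.1, by simp, ?_⟩,
      ⟨Action.mkIso (compactUnifIso Y.V) fun _ => rfl⟩⟩
    rintro _ rfl
    exact (continuous_unifAct_of_bounded Y hY.2).comp
      (continuous_subtype_val.prodMap continuous_id)

end Group

end FlowCat

theorem corollary2p9 :
    -- topological monoids acting on topological spaces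
    (∀ (M : Type v) [Monoid M] [TopologicalSpace M] [ContinuousMul M] (𝒮 𝒥 : Set (Set M))
      (C D : FlowCat.TopClass) (h : (C.prop : ObjectProperty TopCat.{u}) ≤ D.prop),
      Nonempty (Reflective (ObjectProperty.ιOfLE h)) ∧
      Nonempty (Reflective (ObjectProperty.ιOfLE (FlowCat.topFlows_le M 𝒮 𝒥 h)))) ∧
    -- monoids with a uniformity acting on uniform spaces
    (∀ (M : Type v) [Monoid M] [UniformSpace M] (𝒮 𝒥 : Set (Set M))
      (C D : FlowCat.UnifClass) (h : (C.prop : ObjectProperty UniformSpaceCat.{u}) ≤ D.prop),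
      Nonempty (Reflective (ObjectProperty.ιOfLE h)) ∧
      Nonempty (Reflective (ObjectProperty.ιOfLE (FlowCat.unifFlows_le M 𝒮 𝒥 h)))) ∧
    -- compactly generated monoids acting on compactly generated spaces
    (∀ (M : Type v) [Monoid M] [TopologicalSpace M] [FlowCat.IsKMonoid M] (𝒮 𝒥 : Set (Set M))
      (C D : FlowCat.KTopClass) (h : (C.prop : ObjectProperty TopCat.{u}) ≤ D.prop),
      Nonempty (Reflective (ObjectProperty.ιOfLE h)) ∧
      Nonempty (Reflective (ObjectProperty.ιOfLE (FlowCat.kFlows_le M 𝒮 𝒥 h)))) ∧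
    -- topological groups acting on uniform spaces: bounded and quasi-bounded flows
    (∀ (G : Type v) [Group G] [TopologicalSpace G] [IsTopologicalGroup G]
      (C D : FlowCat.UnifClass) (h : (C.prop : ObjectProperty UniformSpaceCat.{u}) ≤ D.prop),
      Nonempty (Reflective (ObjectProperty.ιOfLE (FlowCat.boundedFlows_le G h))) ∧
      Nonempty (Reflective (ObjectProperty.ιOfLE (FlowCat.quasiBoundedFlows_le G h)))) ∧
    -- continuous compact Hausdorff flows of a topological group among its bounded uniform flows
    (∀ (G : Type v) [Group G] [TopologicalSpace G] [IsTopologicalGroup G]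
      (D : FlowCat.UnifClass),
      Nonempty (Reflective (FlowCat.compactToUnif.{u} D)) ∧
      Nonempty (Reflective (FlowCat.compactFlowToBounded.{v, u} G D))) := by
  open FlowCat in
  refine ⟨fun M _ _ _ 𝒮 𝒥 C D h => ⟨?_, ?_⟩, fun M _ _ 𝒮 𝒥 C D h => ⟨?_, ?_⟩,
    fun M _ _ _ 𝒮 𝒥 C D h => ⟨?_, ?_⟩, fun G _ _ _ C D h => ⟨?_, ?_⟩, fun G _ _ _ D =>
      ⟨nonempty_reflective_compactToUnif D, nonempty_reflective_compactFlowToBounded D⟩⟩ <;>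
    refine nonempty_reflective_ιOfLE _ fun X hX => ?_
  · exact hasUniversalArrow_topClass C X
  · exact hasUniversalArrow_topFlows 𝒮 𝒥 C X
  · exact hasUniversalArrow_unifClass C X
  -- The universal arrow exists for every constrained flow on an arbitrary uniform space, so the
  -- membership of `X` in `D` is weakened to `blank`.
  · exact hasUniversalArrow_unifFlows 𝒮 𝒥 C X ⟨trivial, hX.2⟩
  · exact hasUniversalArrow_kTopClass C X (KTopClass.prop_blank hX)
  · exact hasUniversalArrow_kFlows 𝒮 𝒥 C X ⟨KTopClass.prop_blank hX.1, hX.2⟩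
  · exact hasUniversalArrow_boundedFlows C X ⟨trivial, hX.2⟩
  · exact hasUniversalArrow_quasiBoundedFlows C X ⟨trivial, hX.2⟩
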